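/- Let $\mathbb X$ be a set of datasets with an adjacency relation $\simeq$, let $m,n\ge 1$, let $T\in\mathbb N$, $\varepsilon\ge 0$ and $\delta\in(0,1)$. Let $U_1\in\mathbb R^{m\times m}$ and $U_2\in\mathbb R^{n\times n}$ be invertible, and put $\Sigma_k=U_kU_k^\top$. Write $\sigma_1(A)\ge\sigma_2(A)\ge\cdots$ for the singular values of a matrix $A$, so that $\sigma_m(U_1)$ and $\sigma_n(U_2)$ are the smallest singular values of $U_1$ and $U_2$. Let $\mathcal{MN}_{m,n}(0,\Sigma_1,\Sigma_2)$ be the law on $\mathbb R^{m\times n}$ with density $$Z\mapsto\frac{\exp\{-\tfrac12\|U_1^{-1}ZU_2^{-\top}\|_F^2\}}{(2\pi)^{mn/2}\,|\Sigma_1|^{n/2}\,|\Sigma_2|^{m/2}} .$$ A randomized mechanism $K$ is $(\varepsilon,\delta)$-DP if $\Pr(K(X)\in\mathcal O)\le e^{\varepsilon}\Pr(K(X')\in\mathcal O)+\delta$ for all $X\simeq X'$ and all measurable $\mathcal O$. The $\ell_2$-sensitivity of $f:\mathbb X\to\mathbb R^{m\times n}$ is $s_2(f)=\sup_{X\simeq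 X'}\|f(X)-f(X')\|_F$. An IMGM with query $f$ outputs $f(X)+Z$ with $Z\sim\mathcal{MN}_{m,n}(0,\Sigma_1,\Sigma_2)$. Its $T$-fold composition releases $T$ such outputs with independent noises. In an adaptive composition, the $t$-th query $f_t(y_1,\dots,y_{t-1},X)$ may also depend, measurably, on the earlier outputs $y_1,\dots,y_{t-1}$. Then there is exactly one $B>0$ with $g(B)=\delta$, where $$g(x)=\Phi\Big(\frac x2-\frac{\varepsilon}{x}\Big)-e^{\varepsilon}\,\Phi\Big(-\frac x2-\frac{\varepsilon}{x}\Big)$$ and $\Phi$ is the standard normal distribution function. For this $B$ and every real $s\ge 0$ the following hold. 1. If there are two distinct adjacent datasets, then the following three statements are equivalent: (a) $\sigma_m(U_1)\,\sigma_n(U_2)\ge \dfrac{s\sqrt T}{B}$; (b) for every query $f:\mathbb X\to\mathbb R^{m\times n}$ with $s_2(f)=s$, the $T$-fold composition of the IMGM $f(X)+Z$ is $(\varepsilon,\delta)$-DP; (c) for every adaptive sequence of queries $f_1,\dots,f_T$ such that $s_2(f_t(y,\cdot))\le s$ for every $t$ and every sequence $y$ of earlier outputs, the $T$-fold adaptive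 composition of the IMGMs $f_t(y_1,\dots,y_{t-1},X)+Z_t$ is $(\varepsilon,\delta)$-DP. 2. If $f$ is a query with $s_2(f)=s$ such that every $\Delta\in\mathbb R^{m\times n}$ with $\|\Delta\|_F=s$ is of the form $f(X)-f(X')$ with $X\simeq X'$, then the $T$-fold composition of the IMGM $f(X)+Z$ is $(\varepsilon,\delta)$-DP if and only if $\sigma_m(U_1)\,\sigma_n(U_2)\ge \dfrac{s_2(f)\sqrt T}{B}$. -/

import Mathlib

open MeasureTheory ProbabilityTheory
open scoped ENNReal NNReal Matrix

noncomputable section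

namespace IMGM

/-! ### Matrices: measurable structure, Frobenius norm, singular values -/

/-- Real `m × n` matrices carry Lebesgue measure on their `m * n` entries. -/
instance matrixMeasureSpace (m n : ℕ) : MeasureSpace (Matrix (Fin m) (Fin n) ℝ) :=
  inferInstanceAs (MeasureSpace (Fin m → Fin n → ℝ))

instance matrixSigmaFinite (m n : ℕ) :
    SigmaFinite (volume : Measure (Matrix (Fin m) (Fin n) ℝ)) :=
  inferInstanceAs (SigmaFinite (volume : Measure (Fin m → Fin n → ℝ)))

/-- The Frobenius norm. -/
def frobNorm {m n : ℕ} (A : Matrix (Fin m) (Fin n) ℝ) : ℝ :=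
  Real.sqrt (∑ i, ∑ j, A i j ^ 2)

/-- The `i`-th singular value of a square matrix, in non-increasing order and counted from `1`:
`singularValue A 1 ≥ … ≥ singularValue A k` for a `k × k` matrix `A`. -/
def singularValue {k : ℕ} (A : Matrix (Fin k) (Fin k) ℝ) (i : ℕ) : ℝ :=
  (Matrix.toEuclideanLin A).singularValues (i - 1)

/-! ### The matrix Gaussian distribution -/

/-- The density of the matrix Gaussian distribution with mean `M`, row-wise covariance `S₁` and
column-wise covariance `S₂`. -/
def matrixGaussianPDF {m n : ℕ} (M : Matrix (Fin m) (Fin n) ℝ)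
    (S₁ : Matrix (Fin m) (Fin m) ℝ) (S₂ : Matrix (Fin n) (Fin n) ℝ)
    (Z : Matrix (Fin m) (Fin n) ℝ) : ℝ :=
  Real.exp (-(1 / 2) * (S₁⁻¹ * (Z - M) * S₂⁻¹ * (Z - M)ᵀ).trace) /
    ((2 * Real.pi) ^ (((m : ℝ) * n) / 2) * S₁.det ^ ((n : ℝ) / 2) * S₂.det ^ ((m : ℝ) / 2))

/-- The matrix Gaussian distribution with mean `M` and covariances `S₁`, `S₂`. -/
def matrixGaussian {m n : ℕ} (M : Matrix (Fin m) (Fin n) ℝ)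
    (S₁ : Matrix (Fin m) (Fin m) ℝ) (S₂ : Matrix (Fin n) (Fin n) ℝ) :
    Measure (Matrix (Fin m) (Fin n) ℝ) :=
  volume.withDensity fun Z => ENNReal.ofReal (matrixGaussianPDF M S₁ S₂ Z)

instance {m n : ℕ} (M : Matrix (Fin m) (Fin n) ℝ)
    (S₁ : Matrix (Fin m) (Fin m) ℝ) (S₂ : Matrix (Fin n) (Fin n) ℝ) :
    SFinite (matrixGaussian M S₁ S₂) := by
  unfold matrixGaussian; infer_instance

/-- The quadratic form in the density is `‖U₁⁻¹ W U₂⁻ᵀ‖_F ^ 2` for any factorization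
`S₁ = U₁ U₁ᵀ`, `S₂ = U₂ U₂ᵀ`. -/
theorem trace_eq_frobNorm_sq {m n : ℕ} (U₁ : Matrix (Fin m) (Fin m) ℝ)
    (U₂ : Matrix (Fin n) (Fin n) ℝ) (W : Matrix (Fin m) (Fin n) ℝ) :
    ((U₁ * U₁ᵀ)⁻¹ * W * (U₂ * U₂ᵀ)⁻¹ * Wᵀ).trace = frobNorm (U₁⁻¹ * W * (U₂⁻¹)ᵀ) ^ 2 := by
  have h : ∀ A : Matrix (Fin m) (Fin n) ℝ, frobNorm A ^ 2 = (A * Aᵀ).trace := by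
    intro A
    rw [frobNorm, Real.sq_sqrt (by positivity)]
    simp [Matrix.trace, Matrix.mul_apply, sq]
  rw [h, Matrix.mul_inv_rev, Matrix.mul_inv_rev, ← Matrix.transpose_nonsing_inv,
    ← Matrix.transpose_nonsing_inv]
  simp only [Matrix.transpose_mul, Matrix.transpose_transpose, Matrix.mul_assoc]
  rw [Matrix.trace_mul_comm]
  simp only [Matrix.mul_assoc]

/-! ### Differential privacy and sensitivity -/

/-- A randomized mechanism, given by its output laws `K x`, is `(ε, δ)`-differentially private
with respect to the adjacency relation `adj`. -/
def IsDP {X Ω : Type*} [MeasurableSpace Ω] (adj : X → X → Prop) (K : X → Measure Ω)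
    (ε δ : ℝ) : Prop :=
  ∀ x x', adj x x' → ∀ O, MeasurableSet O →
    K x O ≤ ENNReal.ofReal (Real.exp ε) * K x' O + ENNReal.ofReal δ

/-- The `ℓ₂`-sensitivity: the supremum of `‖f x - f x'‖_F` over adjacent pairs, in `[0, ∞]`. -/
def l2Sensitivity {X : Type*} {m n : ℕ} (adj : X → X → Prop)
    (f : X → Matrix (Fin m) (Fin n) ℝ) : ℝ≥0∞ :=
  ⨆ (x) (x') (_ : adj x x'), ENNReal.ofReal (frobNorm (f x - f x'))

/-! ### Composition of mechanisms -/

/-- Adaptive composition. Mechanism number `t` (counted from `0`) sees the dataset and the `t`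
earlier outputs. `adaptiveComposition K T x` is the joint law of the first `T` outputs. -/
def adaptiveComposition {X R : Type*} [MeasurableSpace R]
    (K : (t : ℕ) → X → Kernel (Fin t → R) R) : (T : ℕ) → X → Measure (Fin T → R)
  | 0, _ => Measure.dirac Fin.elim0
  | T + 1, x => (adaptiveComposition K T x ⊗ₘ K T x).map
      fun p => Fin.snoc (α := fun _ => R) p.1 p.2

theorem measurable_finSnoc {R : Type*} [MeasurableSpace R] (T : ℕ) :
    Measurable fun p : (Fin T → R) × R => Fin.snoc (α := fun _ => R) p.1 p.2 := by
  refine measurable_pi_lambda _ fun i => ?_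
  refine Fin.lastCases ?_ (fun j => ?_) i
  · simpa using measurable_snd
  · simp only [Fin.snoc_castSucc]
    exact (measurable_pi_apply j).comp measurable_fst

theorem measurable_matrix_add {m n : ℕ} :
    Measurable fun p : Matrix (Fin m) (Fin n) ℝ × Matrix (Fin m) (Fin n) ℝ => p.1 + p.2 := by
  have : Measurable fun p : (Fin m → Fin n → ℝ) × (Fin m → Fin n → ℝ) => p.1 + p.2 := by
    fun_prop
  exact this

/-- The improved matrix Gaussian mechanism `q y + Z` with `Z ∼ MN(0, S₁, S₂)`, where the query
`q y` may depend on earlier outputs `y`. -/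
def imgm {Y : Type*} [MeasurableSpace Y] {m n : ℕ}
    (S₁ : Matrix (Fin m) (Fin m) ℝ) (S₂ : Matrix (Fin n) (Fin n) ℝ)
    (q : Y → Matrix (Fin m) (Fin n) ℝ) (hq : Measurable q) :
    Kernel Y (Matrix (Fin m) (Fin n) ℝ) where
  toFun y := (matrixGaussian 0 S₁ S₂).map fun Z => q y + Z
  measurable' := by
    have h : Measurable fun p : Y × Matrix (Fin m) (Fin n) ℝ => q p.1 + p.2 :=
      measurable_matrix_add.comp ((hq.comp measurable_fst).prodMk measurable_snd)
    refine Measure.measurable_of_measurable_coe _ fun s hs => ?_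
    have h2 : (fun y => ((matrixGaussian 0 S₁ S₂).map fun Z => q y + Z) s) =
        fun y => matrixGaussian 0 S₁ S₂ (Prod.mk y ⁻¹' ((fun p => q p.1 + p.2) ⁻¹' s)) := by
      funext y
      rw [Measure.map_apply (f := fun Z => q y + Z) (h.comp measurable_prodMk_left) hs]
      rfl
    rw [h2]
    exact measurable_measure_prodMk_left (h hs)

instance {Y : Type*} [MeasurableSpace Y] {m n : ℕ}
    (S₁ : Matrix (Fin m) (Fin m) ℝ) (S₂ : Matrix (Fin n) (Fin n) ℝ)
    (q : Y → Matrix (Fin m) (Fin n) ℝ) (hq : Measurable q) :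
    IsSFiniteKernel (imgm S₁ S₂ q hq) := by
  have h : Measurable fun p : Y × Matrix (Fin m) (Fin n) ℝ => q p.1 + p.2 :=
    measurable_matrix_add.comp ((hq.comp measurable_fst).prodMk measurable_snd)
  have h2 : imgm S₁ S₂ q hq =
      (Kernel.id ×ₖ Kernel.const Y (matrixGaussian 0 S₁ S₂)).map (fun p => q p.1 + p.2) := by
    ext y s hs
    rw [Kernel.map_apply' _ h _ hs, Kernel.prod_apply' _ _ _ (h hs), Kernel.id_apply,
      lintegral_dirac' _ (by
        simp only [Kernel.const_apply]
        exact measurable_measure_prodMk_left (h hs)), Kernel.const_apply]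
    change ((matrixGaussian 0 S₁ S₂).map fun Z => q y + Z) s = _
    rw [Measure.map_apply (f := fun Z => q y + Z) (h.comp measurable_prodMk_left) hs]
    rfl
  rw [h2]
  infer_instance

/-- The `T`-fold adaptive composition of improved matrix Gaussian mechanisms: the `t`-th output is
`f t (earlier outputs) x + Z_t` with fresh noise `Z_t ∼ MN(0, S₁, S₂)`. -/
def adaptiveIMGM {X : Type*} {m n : ℕ}
    (S₁ : Matrix (Fin m) (Fin m) ℝ) (S₂ : Matrix (Fin n) (Fin n) ℝ)
    (f : (t : ℕ) → (Fin t → Matrix (Fin m) (Fin n) ℝ) → X → Matrix (Fin m) (Fin n) ℝ)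
    (hf : ∀ t x, Measurable fun y => f t y x) (T : ℕ) (x : X) :
    Measure (Fin T → Matrix (Fin m) (Fin n) ℝ) :=
  adaptiveComposition (fun t x => imgm S₁ S₂ (fun y => f t y x) (hf t x)) T x

/-- The `T`-fold composition of the mechanism `f x + Z`, `Z ∼ MN(0, S₁, S₂)`, with one and the
same query `f` in every round. -/
def composedIMGM {X : Type*} {m n : ℕ}
    (S₁ : Matrix (Fin m) (Fin m) ℝ) (S₂ : Matrix (Fin n) (Fin n) ℝ)
    (f : X → Matrix (Fin m) (Fin n) ℝ) (T : ℕ) (x : X) :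
    Measure (Fin T → Matrix (Fin m) (Fin n) ℝ) :=
  adaptiveIMGM S₁ S₂ (fun _ _ => f) (fun _ _ => measurable_const) T x

/-! ### The function whose root is the privacy bound -/

/-- The standard normal distribution function. -/
def Phi (x : ℝ) : ℝ := cdf (gaussianReal 0 1) x

/-- `g(x) = Φ(x/2 - ε/x) - e^ε Φ(-x/2 - ε/x)`, used for `x > 0`. -/
def g (ε x : ℝ) : ℝ :=
  Phi (x / 2 - ε / x) - Real.exp ε * Phi (-(x / 2) - ε / x)

end IMGM

end

/-!
The hockey-stick divergences of two laws `P`, `Q`, that is, the suprema of `b P(O) - c Q(O)` over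
measurable `O`, decide whether a mechanism is `(ε, δ)`-DP. For two unit-variance Gaussians at
squared distance `v` they are `hockeyStick v b c = ∫ (b e^w - c)₊ dN(-v/2, v)(w)`, because the
log-likelihood ratio `w` has law `N(-v/2, v)` under the second Gaussian. For `b = 1`, `c = e^ε` this
number is `g ε √v` (`hockeyStick_one_eexp`), and `g ε` increases strictly from `0` to `1` on
`(0, ∞)`, since its derivative is a Gaussian density (`hasDerivAt_g`). Hence `B` exists and is
unique, and the divergence is at most `δ` exactly if `√v ≤ B` (`hockeyStick_le_iff`).

One round of the mechanism, at two datasets whose query values differ by `D`, is the image under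
`W ↦ U₁ W U₂ᵀ` of two standard Gaussian matrices whose means differ by `U₁⁻¹ D U₂⁻ᵀ`, so its
log-likelihood ratio is Gaussian with `v = ‖U₁⁻¹ D U₂⁻ᵀ‖_F²` (`gaussianLoss_matrixGaussian`). The
largest value of this norm over `‖D‖_F = s` is `s / (σ_m(U₁) σ_n(U₂))`; it is attained by the image
of a rank-one matrix of minimal right singular vectors (`singularValue_mul_mul_frobNorm_le`,
`exists_worst_case`).

*Sufficiency, for adaptive queries.* In an adaptive composition the log-likelihood ratio need not be
Gaussian, as the distance in a round depends on the earlier outputs. The divergences are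
nevertheless at most those of the Gaussian pair at the sum of the squared distances (`Dominated.compProd`):
conditionally on the earlier outputs, the last round is replaced by the Gaussian pair, whose loss
`w` only reweights `b` to `b e^w` in the divergence of the earlier rounds. The induction hypothesis
applies for each `w`, and integrating over `w` convolves two Gaussian loss laws, so that `v` and
`v'` give `v + v'`. Rounds with a smaller distance are covered by `hockeyStick_mono`.

*Necessity, for a fixed query.* The rounds are independent, so their Gaussian losses add up to the
loss at squared distance `T v`, and the bound is an equality at a superlevel set of the likelihood
ratio (`GaussianLoss.exists_eq`). With the worst-case difference `D`, privacy therefore forces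
`√T s / (σ_m(U₁) σ_n(U₂)) ≤ B`.
-/

noncomputable section

namespace IMGM

/-! ### Hockey-stick divergence and Gaussian privacy loss -/

/-- The law of the privacy loss between two unit-variance Gaussians at squared distance `v`, seen
from the second of the two. -/
def lossLaw (v : ℝ≥0) : Measure ℝ := gaussianReal (-(v : ℝ) / 2) v

instance (v : ℝ≥0) : IsProbabilityMeasure (lossLaw v) := by unfold lossLaw; infer_instance

/-- The function `w ↦ exp w` with values in `[0, ∞]`. -/
def eexp (w : ℝ) : ℝ≥0∞ := ENNReal.ofReal (Real.exp w)

@[fun_prop]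
theorem measurable_eexp : Measurable eexp := by unfold eexp; fun_prop

theorem eexp_add (v w : ℝ) : eexp (v + w) = eexp v * eexp w := by
  rw [eexp, Real.exp_add, ENNReal.ofReal_mul (Real.exp_pos _).le]; rfl

theorem eexp_ne_top (w : ℝ) : eexp w ≠ ∞ := ENNReal.ofReal_ne_top

/-- The weighted hockey-stick divergence `∫ (b e^w - c)₊` of two unit-variance Gaussians at squared
distance `v`, expressed through the law of their privacy loss. The subtraction is the truncated
one of `[0, ∞]`, so that the positive part is built in. -/
def hockeyStick (v : ℝ≥0) (b c : ℝ≥0∞) : ℝ≥0∞ := ∫⁻ w, b * eexp w - c ∂lossLaw v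

theorem lossLaw_conv (v v' : ℝ≥0) : lossLaw v ∗ lossLaw v' = lossLaw (v + v') := by
  rw [lossLaw, lossLaw, gaussianReal_conv_gaussianReal, lossLaw]
  congr 1
  push_cast
  ring

theorem measurable_hockeyStick (v : ℝ≥0) :
    Measurable fun p : ℝ≥0∞ × ℝ≥0∞ => hockeyStick v p.1 p.2 := by
  unfold hockeyStick
  refine Measurable.lintegral_prod_right' (ν := lossLaw v)
    (f := fun p : (ℝ≥0∞ × ℝ≥0∞) × ℝ => p.1.1 * eexp p.2 - p.1.2) ?_
  fun_prop

/-- Averaging over an independent loss `w` that reweights `b` to `b e^w` adds the squared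
distances. -/
theorem lintegral_hockeyStick (v v' : ℝ≥0) (b c : ℝ≥0∞) :
    ∫⁻ w, hockeyStick v' (b * eexp w) c ∂lossLaw v = hockeyStick (v + v') b c := by
  rw [hockeyStick, ← lossLaw_conv, Measure.lintegral_conv (by fun_prop)]
  simp only [eexp_add, hockeyStick, mul_assoc]

theorem lintegral_eexp_lossLaw (v : ℝ≥0) : ∫⁻ w, eexp w ∂lossLaw v = 1 := by
  have h := integrable_exp_mul_gaussianReal (μ := -(v : ℝ) / 2) (v := v) 1
  have h2 := congrFun (mgf_id_gaussianReal (μ := -(v : ℝ) / 2) (v := v)) 1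
  simp only [one_mul] at h
  simp only [mgf, id, one_mul] at h2
  unfold eexp lossLaw
  rw [← ofReal_integral_eq_lintegral_ofReal h (.of_forall fun _ => (Real.exp_pos _).le), h2]
  simp only [mul_one, one_pow]
  rw [show -(v : ℝ) / 2 + v / 2 = 0 by ring]
  simp

/-- Conditioning on part of the privacy loss and Jensen's inequality show that a larger squared
distance gives a larger divergence. -/
theorem hockeyStick_mono {v v' : ℝ≥0} (h : v ≤ v') (b c : ℝ≥0∞) :
    hockeyStick v b c ≤ hockeyStick v' b c := by
  obtain ⟨u, rfl⟩ := exists_add_of_le h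
  rw [← lintegral_hockeyStick]
  refine lintegral_mono fun w => ?_
  have h1 := lintegral_sub_le' (μ := lossLaw u) (fun _ => c) (fun w' => b * eexp w * eexp w')
    (by fun_prop)
  rw [lintegral_const_mul _ (by fun_prop), lintegral_eexp_lossLaw] at h1
  simpa [hockeyStick] using h1

/-- `Dominated P Q v`: all weighted hockey-stick divergences of `(P, Q)` are at most those of two
unit-variance Gaussians at squared distance `v`. The weight `c` is finite so that `c * Q O` can be
subtracted for finite `Q`. -/
def Dominated {Ω : Type*} [MeasurableSpace Ω] (P Q : Measure Ω) (v : ℝ≥0) : Prop :=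
  ∀ b c : ℝ≥0∞, c ≠ ∞ → ∀ O, MeasurableSet O → b * P O ≤ c * Q O + hockeyStick v b c

/-- `GaussianLoss P Q v`: the logarithm of the likelihood ratio of `P` to `Q` has the same law as
for two unit-variance Gaussians at squared distance `v`. -/
def GaussianLoss {Ω : Type*} [MeasurableSpace Ω] (P Q : Measure Ω) (v : ℝ≥0) : Prop :=
  ∃ l : Ω → ℝ, Measurable l ∧ P = Q.withDensity (fun z => eexp (l z)) ∧ Q.map l = lossLaw v

section
variable {Ω Ω' : Type*} [MeasurableSpace Ω] [MeasurableSpace Ω']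

theorem Dominated.mono {P Q : Measure Ω} {v v' : ℝ≥0} (h : Dominated P Q v) (hv : v ≤ v') :
    Dominated P Q v' := fun b c hc O hO =>
  (h b c hc O hO).trans (by gcongr; exact hockeyStick_mono hv b c)

theorem Dominated.map {P Q : Measure Ω} {v : ℝ≥0} (h : Dominated P Q v) {e : Ω → Ω'}
    (he : Measurable e) : Dominated (P.map e) (Q.map e) v := fun b c hc O hO => by
  rw [Measure.map_apply he hO, Measure.map_apply he hO]
  exact h b c hc _ (he hO)

theorem GaussianLoss.dominated {P Q : Measure Ω} {v : ℝ≥0} (h : GaussianLoss P Q v) :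
    Dominated P Q v := by
  obtain ⟨l, hl, rfl, hQ⟩ := h
  intro b c _ O hO
  rw [withDensity_apply _ hO, ← lintegral_const_mul _ (by fun_prop), hockeyStick, ← hQ,
    lintegral_map (by fun_prop) hl]
  calc ∫⁻ z in O, b * eexp (l z) ∂Q ≤ ∫⁻ z in O, c + (b * eexp (l z) - c) ∂Q :=
        lintegral_mono fun z => le_add_tsub
    _ = c * Q O + ∫⁻ z in O, (b * eexp (l z) - c) ∂Q := by
        rw [lintegral_add_left (by fun_prop), setLIntegral_const]
    _ ≤ _ := by gcongr; exact Measure.restrict_le_self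

/-- At the set where the loss is at least the logarithm of `c`, the bound of
`GaussianLoss.dominated` is an equality. -/
theorem withDensity_eexp_superlevel {Q : Measure Ω} {v : ℝ≥0} {l : Ω → ℝ} (hl : Measurable l)
    (hQ : Q.map l = lossLaw v) (c : ℝ≥0∞) :
    Q.withDensity (fun z => eexp (l z)) {z | c ≤ eexp (l z)} =
      c * Q {z | c ≤ eexp (l z)} + hockeyStick v 1 c := by
  have hO : MeasurableSet {z | c ≤ eexp (l z)} := measurableSet_le (by fun_prop) (by fun_prop)
  rw [withDensity_apply _ hO, hockeyStick, ← hQ, lintegral_map (by fun_prop) hl]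
  have h1 : ∫⁻ z, (1 * eexp (l z) - c) ∂Q = ∫⁻ z in {z | c ≤ eexp (l z)}, (eexp (l z) - c) ∂Q := by
    rw [← lintegral_indicator hO]
    refine lintegral_congr fun z => ?_
    by_cases hz : c ≤ eexp (l z)
    · simp [hz]
    · simp [hz, tsub_eq_zero_of_le (not_le.mp hz).le]
  rw [h1, ← setLIntegral_const, ← lintegral_add_left (by fun_prop)]
  exact setLIntegral_congr_fun hO fun z hz => (add_tsub_cancel_of_le hz).symm

theorem GaussianLoss.exists_eq {P Q : Measure Ω} {v : ℝ≥0} (h : GaussianLoss P Q v)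
    (c : ℝ≥0∞) : ∃ O, MeasurableSet O ∧ P O = c * Q O + hockeyStick v 1 c := by
  obtain ⟨l, hl, rfl, hQ⟩ := h
  exact ⟨_, measurableSet_le (by fun_prop) (by fun_prop), withDensity_eexp_superlevel hl hQ c⟩

theorem GaussianLoss.prod {P Q : Measure Ω} {P' Q' : Measure Ω'} [SFinite Q] [SFinite Q']
    {v v' : ℝ≥0} (h : GaussianLoss P Q v) (h' : GaussianLoss P' Q' v') :
    GaussianLoss (P.prod P') (Q.prod Q') (v + v') := by
  obtain ⟨l, hl, rfl, hQ⟩ := h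
  obtain ⟨l', hl', rfl, hQ'⟩ := h'
  refine ⟨fun z => l z.1 + l' z.2, by fun_prop, ?_, ?_⟩
  · rw [prod_withDensity (by fun_prop) (by fun_prop)]
    simp only [eexp_add]
  · have : (fun z : Ω × Ω' => l z.1 + l' z.2) = (fun p : ℝ × ℝ => p.1 + p.2) ∘ Prod.map l l' := rfl
    rw [this, ← Measure.map_map (by fun_prop) (by fun_prop), ← Measure.map_prod_map _ _ hl hl',
      hQ, hQ', ← lossLaw_conv]
    rfl

theorem map_withDensity (μ : Measure Ω) (f : Ω → ℝ≥0∞) (e : Ω ≃ᵐ Ω') :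
    (μ.withDensity f).map e = (μ.map e).withDensity (f ∘ e.symm) := by
  ext O hO
  rw [e.map_apply, withDensity_apply _ (e.measurable hO), withDensity_apply _ hO, e.restrict_map,
    lintegral_map_equiv]
  simp

theorem GaussianLoss.map {P Q : Measure Ω} {v : ℝ≥0} (h : GaussianLoss P Q v) (e : Ω ≃ᵐ Ω') :
    GaussianLoss (P.map e) (Q.map e) v := by
  obtain ⟨l, hl, rfl, hQ⟩ := h
  refine ⟨l ∘ e.symm, hl.comp e.symm.measurable, map_withDensity _ _ _, ?_⟩
  · rw [Measure.map_map (hl.comp e.symm.measurable) e.measurable, ← hQ]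
    congr 1
    ext z
    simp

theorem GaussianLoss.refl (P : Measure Ω) [IsProbabilityMeasure P] : GaussianLoss P P 0 := by
  refine ⟨fun _ => 0, measurable_const, by simp [eexp], ?_⟩
  simp [lossLaw, gaussianReal_zero_var, Measure.map_const]

theorem GaussianLoss.pi {n : ℕ} {P Q : Fin n → Measure Ω} [∀ i, IsProbabilityMeasure (P i)]
    [∀ i, IsProbabilityMeasure (Q i)] {v : Fin n → ℝ≥0} (h : ∀ i, GaussianLoss (P i) (Q i) (v i)) :
    GaussianLoss (Measure.pi P) (Measure.pi Q) (∑ i, v i) := by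
  induction n with
  | zero =>
    rw [Measure.pi_of_empty P, Measure.pi_of_empty Q]
    simpa using GaussianLoss.refl _
  | succ n ih =>
    have hP := (measurePreserving_piFinSuccAbove P 0).symm.map_eq
    have hQ := (measurePreserving_piFinSuccAbove Q 0).symm.map_eq
    rw [← hP, ← hQ, Fin.sum_univ_succ]
    exact ((h 0).prod (ih fun i => h _)).map _

theorem gaussianLoss_gaussianReal (a a' : ℝ) :
    GaussianLoss (gaussianReal a 1) (gaussianReal a' 1) (Real.toNNReal ((a - a') ^ 2)) := by
  -- the logarithm of the ratio of the two densities
  refine ⟨fun w => (a - a') * w - (a ^ 2 - a' ^ 2) / 2, by fun_prop, ?_, ?_⟩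
  · rw [gaussianReal_of_var_ne_zero _ one_ne_zero, gaussianReal_of_var_ne_zero _ one_ne_zero,
      ← withDensity_mul _ (measurable_gaussianPDF _ _) (by fun_prop)]
    congr 1
    ext w
    simp only [Pi.mul_apply, gaussianPDF, eexp, gaussianPDFReal]
    rw [← ENNReal.ofReal_mul (by positivity), mul_assoc _ (Real.exp _) (Real.exp _),
      ← Real.exp_add]
    congr 3
    push_cast
    ring
  · have : (fun w : ℝ => (a - a') * w - (a ^ 2 - a' ^ 2) / 2) =
        (fun w => w - (a ^ 2 - a' ^ 2) / 2) ∘ fun w => (a - a') * w := rfl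
    rw [this, ← Measure.map_map (by fun_prop) (by fun_prop), gaussianReal_map_const_mul,
      gaussianReal_map_sub_const, lossLaw, Real.coe_toNNReal _ (sq_nonneg _)]
    congr 1
    · ring
    · ext
      simp [Real.coe_toNNReal _ (sq_nonneg _)]

end

/-! ### Adaptive composition of dominated pairs -/

section
variable {Ω Ω' : Type*} [MeasurableSpace Ω] [MeasurableSpace Ω']

/-- Domination in terms of densities with respect to a common measure, where the hockey-stick
divergence of `(P, Q)` is an integral. -/
theorem Dominated.lintegral_rnDeriv_le {P Q ν : Measure Ω} [IsFiniteMeasure P] [IsFiniteMeasure Q]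
    [SigmaFinite ν] (hP : P ≪ ν) (hQ : Q ≪ ν) {v : ℝ≥0} (h : Dominated P Q v) (b c : ℝ≥0∞)
    (hc : c ≠ ∞) :
    ∫⁻ y, (b * P.rnDeriv ν y - c * Q.rnDeriv ν y) ∂ν ≤ hockeyStick v b c := by
  have hp := P.measurable_rnDeriv ν
  have hq := Q.measurable_rnDeriv ν
  set p := P.rnDeriv ν with hpdef
  set q := Q.rnDeriv ν with hqdef
  -- the set on which the supremum defining the divergence is attained
  set O := {y | c * q y ≤ b * p y} with hOdef
  have hO : MeasurableSet O := measurableSet_le (by fun_prop) (by fun_prop)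
  have h1 : ∫⁻ y, (b * p y - c * q y) ∂ν = ∫⁻ y in O, (b * p y - c * q y) ∂ν := by
    rw [← lintegral_indicator hO]
    refine lintegral_congr fun y => ?_
    by_cases hy : c * q y ≤ b * p y
    · simp [hOdef, hy]
    · simp [hOdef, hy, tsub_eq_zero_of_le (not_le.mp hy).le]
  have h2 : ∫⁻ y in O, b * p y ∂ν = b * P O := by
    rw [lintegral_const_mul _ hp, Measure.setLIntegral_rnDeriv hP]
  have h3 : ∫⁻ y in O, c * q y ∂ν = c * Q O := by
    rw [lintegral_const_mul _ hq, Measure.setLIntegral_rnDeriv hQ]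
  have h4 : c * Q O ≠ ∞ := ENNReal.mul_ne_top hc (measure_ne_top _ _)
  rw [h1, lintegral_sub (by fun_prop) (h3 ▸ h4)
    ((ae_restrict_iff' hO).mpr (.of_forall fun y hy => hy)), h2, h3, tsub_le_iff_left]
  exact h b c hc O hO

/-- Adaptive composition: the squared distances add up. Conditionally on the first output, the
second pair of laws may be replaced by the Gaussian pair, whose loss `w` reweights the first pair
by `e ^ w`; then the first pair is replaced, and the two losses add up to a Gaussian one. -/
theorem Dominated.compProd {P Q : Measure Ω} [IsFiniteMeasure P] [IsFiniteMeasure Q]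
    {κ η : Kernel Ω Ω'} [IsMarkovKernel κ] [IsMarkovKernel η] {v v' : ℝ≥0}
    (h : Dominated P Q v) (h' : ∀ y, Dominated (κ y) (η y) v') :
    Dominated (P ⊗ₘ κ) (Q ⊗ₘ η) (v + v') := by
  intro b c hc O hO
  set ν := P + Q with hν
  have hP : P ≪ ν := Measure.absolutelyContinuous_of_le (Measure.le_add_right le_rfl)
  have hQ : Q ≪ ν := Measure.absolutelyContinuous_of_le (Measure.le_add_left le_rfl)
  have hp := P.measurable_rnDeriv ν
  have hq := Q.measurable_rnDeriv ν
  have hκ : Measurable fun y => κ y (Prod.mk y ⁻¹' O) := Kernel.measurable_kernel_prodMk_left hO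
  have hη : Measurable fun y => η y (Prod.mk y ⁻¹' O) := Kernel.measurable_kernel_prodMk_left hO
  have hq_top := Q.rnDeriv_ne_top ν
  rw [Measure.compProd_apply hO, Measure.compProd_apply hO,
    ← lintegral_rnDeriv_mul hP hκ.aemeasurable, ← lintegral_rnDeriv_mul hQ hη.aemeasurable,
    ← lintegral_const_mul _ (hp.fun_mul hκ), ← lintegral_const_mul _ (hq.fun_mul hη)]
  set p := P.rnDeriv ν with hpdef
  set q := Q.rnDeriv ν with hqdef
  have hE : Measurable fun y => hockeyStick v' (b * p y) (c * q y) :=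
    (measurable_hockeyStick v').comp (by fun_prop : Measurable fun y => (b * p y, c * q y))
  calc ∫⁻ y, b * (p y * κ y (Prod.mk y ⁻¹' O)) ∂ν
      ≤ ∫⁻ y, c * (q y * η y (Prod.mk y ⁻¹' O)) + hockeyStick v' (b * p y) (c * q y) ∂ν := by
        refine lintegral_mono_ae ?_
        filter_upwards [hq_top] with y hy
        rw [← mul_assoc, ← mul_assoc]
        exact h' y _ _ (ENNReal.mul_ne_top hc hy) _ (measurable_prodMk_left hO)
    _ = ∫⁻ y, c * (q y * η y (Prod.mk y ⁻¹' O)) ∂ν +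
          ∫⁻ w, ∫⁻ y, (b * eexp w * p y - c * q y) ∂ν ∂lossLaw v' := by
        rw [lintegral_add_right _ hE, lintegral_lintegral_swap
          (f := fun w y => b * eexp w * p y - c * q y)
          (by unfold Function.uncurry; fun_prop)]
        simp only [hockeyStick, mul_right_comm]
    _ ≤ ∫⁻ y, c * (q y * η y (Prod.mk y ⁻¹' O)) ∂ν +
          ∫⁻ w, hockeyStick v (b * eexp w) c ∂lossLaw v' := by
        gcongr with w
        exact h.lintegral_rnDeriv_le hP hQ _ _ hc
    _ = _ := by rw [lintegral_hockeyStick, add_comm v']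

end

/-! ### The privacy curve `g` of two unit-variance Gaussians -/

theorem hasDerivAt_Phi (x : ℝ) : HasDerivAt Phi (gaussianPDFReal 0 1 x) x := by
  have hc : Continuous (gaussianPDFReal 0 1) := by
    unfold gaussianPDFReal; fun_prop
  have hi := integrable_gaussianPDFReal 0 1
  have h1 : Phi = fun x => Phi 0 + ∫ t in (0 : ℝ)..x, gaussianPDFReal 0 1 t := by
    ext x
    have : ∀ x, Phi x = ∫ t in Set.Iic x, gaussianPDFReal 0 1 t := by
      intro x
      rw [Phi, cdf_eq_real, measureReal_def, gaussianReal_apply_eq_integral _ one_ne_zero,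
        ENNReal.toReal_ofReal (integral_nonneg fun t => gaussianPDFReal_nonneg _ _ _)]
    rw [this, this, ← intervalIntegral.integral_Iic_sub_Iic hi.integrableOn hi.integrableOn]
    ring
  rw [h1]
  exact (intervalIntegral.integral_hasDerivAt_right (hc.intervalIntegrable _ _)
    (hc.stronglyMeasurableAtFilter _ _) hc.continuousAt).const_add _

/-- `g' x = φ(x/2 - ε/x)`: the terms in `ε / x ^ 2` cancel because
`e^ε φ(x/2 + ε/x) = φ(x/2 - ε/x)`. -/
theorem hasDerivAt_g (ε : ℝ) {x : ℝ} (hx : x ≠ 0) :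
    HasDerivAt (g ε) (gaussianPDFReal 0 1 (x / 2 - ε / x)) x := by
  have hd : HasDerivAt (fun x : ℝ => ε / x) (-ε / x ^ 2) x := by
    simpa using (hasDerivAt_const x ε).fun_div (hasDerivAt_id' x) hx
  have h1 := (hasDerivAt_Phi (x / 2 - ε / x)).comp x (((hasDerivAt_id x).div_const 2).sub hd)
  have h2 := (hasDerivAt_Phi (-(x / 2) - ε / x)).comp x
    (((hasDerivAt_id x).div_const 2).neg.sub hd)
  have h3 : Real.exp ε * gaussianPDFReal 0 1 (-(x / 2) - ε / x) =
      gaussianPDFReal 0 1 (x / 2 - ε / x) := by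
    simp only [gaussianPDFReal]
    rw [mul_left_comm, ← Real.exp_add]
    congr 2
    push_cast
    field_simp
    ring
  refine (h1.sub (h2.const_mul (Real.exp ε))).congr_deriv ?_
  rw [← mul_assoc, h3]
  ring

theorem strictMonoOn_g (ε : ℝ) : StrictMonoOn (g ε) (Set.Ioi 0) := by
  refine strictMonoOn_of_deriv_pos (convex_Ioi 0)
    (fun x hx => (hasDerivAt_g ε (ne_of_gt hx)).continuousAt.continuousWithinAt) fun x hx => ?_
  rw [interior_Ioi] at hx
  rw [(hasDerivAt_g ε (ne_of_gt hx)).deriv]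
  exact gaussianPDFReal_pos _ _ _ one_ne_zero

theorem g_def (ε : ℝ) :
    g ε = fun x => Phi (x / 2 - ε / x) - Real.exp ε * Phi (-(x / 2) - ε / x) := rfl

open Filter Topology in
theorem tendsto_g_atTop (ε : ℝ) : Tendsto (g ε) atTop (𝓝 1) := by
  have h0 : Tendsto (fun x : ℝ => -(ε / x)) atTop (𝓝 0) := by
    simpa using (tendsto_const_nhds.div_atTop tendsto_id : Tendsto (fun x : ℝ => ε / x) _ _).neg
  have hx : Tendsto (fun x : ℝ => x / 2) atTop atTop := tendsto_id.atTop_div_const two_pos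
  have h1 := (tendsto_cdf_atTop (gaussianReal 0 1)).comp (hx.atTop_add h0)
  have h2 := (tendsto_cdf_atBot (gaussianReal 0 1)).comp
    ((tendsto_neg_atTop_atBot.comp hx).atBot_add h0)
  simpa [g_def, Phi, Function.comp_def, sub_eq_add_neg] using h1.sub (h2.const_mul (Real.exp ε))

open Filter Topology in
theorem tendsto_g_zero {ε : ℝ} (hε : 0 ≤ ε) : Tendsto (g ε) (𝓝[>] 0) (𝓝 0) := by
  have hx : Tendsto (fun x : ℝ => x / 2) (𝓝[>] 0) (𝓝 0) := by
    have : ContinuousAt (fun x : ℝ => x / 2) 0 := by fun_prop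
    simpa using this.tendsto.mono_left nhdsWithin_le_nhds
  rcases hε.eq_or_lt with rfl | hε
  · have hc := (hasDerivAt_Phi 0).continuousAt.tendsto
    have h1 := hc.comp hx
    have h2 : Tendsto (fun x : ℝ => Phi (-(x / 2))) (𝓝[>] 0) (𝓝 (Phi 0)) :=
      hc.comp (by simpa using hx.neg)
    simpa [g_def, Function.comp_def] using h1.sub h2
  · have h0 : Tendsto (fun x : ℝ => -(ε / x)) (𝓝[>] 0) atBot :=
      tendsto_neg_atTop_atBot.comp (tendsto_inv_nhdsGT_zero.const_mul_atTop hε)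
    have h1 := (tendsto_cdf_atBot (gaussianReal 0 1)).comp (hx.add_atBot h0)
    have h2 := (tendsto_cdf_atBot (gaussianReal 0 1)).comp (hx.neg.add_atBot h0)
    simpa [g_def, Phi, Function.comp_def, sub_eq_add_neg] using h1.sub (h2.const_mul (Real.exp ε))

theorem existsUnique_g_eq {ε δ : ℝ} (hε : 0 ≤ ε) (hδ : 0 < δ) (hδ' : δ < 1) :
    ∃! B : ℝ, 0 < B ∧ g ε B = δ := by
  obtain ⟨a, hga, ha⟩ := (((tendsto_g_zero hε).eventually (gt_mem_nhds hδ)).and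
    self_mem_nhdsWithin).exists
  obtain ⟨b, hgb, hb⟩ := (((tendsto_g_atTop ε).eventually (lt_mem_nhds hδ')).and
    (Filter.eventually_ge_atTop a)).exists
  obtain ⟨B, hB, hgB⟩ := intermediate_value_Icc hb
    (fun x hx => (hasDerivAt_g ε (lt_of_lt_of_le ha hx.1).ne').continuousAt.continuousWithinAt)
    ⟨hga.le, hgb.le⟩
  refine ⟨B, ⟨lt_of_lt_of_le ha hB.1, hgB⟩, fun B' hB' => ?_⟩
  exact (strictMonoOn_g ε).injOn hB'.1 (lt_of_lt_of_le ha hB.1) (hB'.2.trans hgB.symm)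

theorem Phi_nonneg (x : ℝ) : 0 ≤ Phi x := cdf_nonneg _ _

/-- Upper tails of a Gaussian law. -/
theorem gaussianReal_Ici (a t : ℝ) {v : ℝ≥0} (hv : v ≠ 0) :
    gaussianReal a v (Set.Ici t) = ENNReal.ofReal (Phi ((a - t) / Real.sqrt v)) := by
  have hs : 0 < Real.sqrt v := Real.sqrt_pos.mpr (by positivity)
  have h : gaussianReal a v = (gaussianReal 0 1).map (fun x => a - Real.sqrt v * x) := by
    have : (fun x => a - Real.sqrt v * x) = (fun x => a - x) ∘ fun x => Real.sqrt v * x := rfl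
    rw [this, ← Measure.map_map (by fun_prop) (by fun_prop), gaussianReal_map_const_mul,
      gaussianReal_map_const_sub]
    congr 1
    · simp
    · ext; simp
  rw [h, Measure.map_apply (by fun_prop) measurableSet_Ici, Phi, cdf_eq_real,
    ofReal_measureReal]
  congr 1
  ext x
  simp only [Set.mem_preimage, Set.mem_Ici, Set.mem_Iic, le_div_iff₀ hs]
  constructor <;> intro h <;> linarith

/-- The function `g` is the hockey-stick divergence of order `e ^ ε` of two unit-variance Gaussians,
as a function of their distance. -/
theorem hockeyStick_one_eexp (ε : ℝ) {v : ℝ≥0} (hv : v ≠ 0) :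
    hockeyStick v 1 (eexp ε) = ENNReal.ofReal (g ε (Real.sqrt v)) := by
  have hs : 0 < Real.sqrt v := Real.sqrt_pos.mpr (by positivity)
  have hsq : Real.sqrt v * Real.sqrt v = v := Real.mul_self_sqrt v.2
  have hO : {w : ℝ | eexp ε ≤ eexp w} = Set.Ici ε := by
    ext w
    simp [eexp, ENNReal.ofReal_le_ofReal_iff (Real.exp_pos _).le]
  -- the loss itself is the identity on the line, and its superlevel set is a half-line
  have h := withDensity_eexp_superlevel measurable_id (Measure.map_id (μ := lossLaw v)) (eexp ε)
  have h2 : (lossLaw v).withDensity (fun w => eexp (id w)) = gaussianReal ((v : ℝ) / 2) v := by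
    rw [lossLaw, gaussianReal_of_var_ne_zero _ hv, gaussianReal_of_var_ne_zero _ hv,
      ← withDensity_mul _ (measurable_gaussianPDF _ _) (by fun_prop)]
    congr 1
    ext w
    simp only [Pi.mul_apply, gaussianPDF, eexp, gaussianPDFReal, id]
    rw [← ENNReal.ofReal_mul (by positivity), mul_assoc _ (Real.exp _) (Real.exp _),
      ← Real.exp_add]
    congr 3
    have : (v : ℝ) ≠ 0 := by exact_mod_cast hv
    field_simp
    ring
  simp only [id] at h h2
  rw [h2, hO, lossLaw, gaussianReal_Ici _ _ hv, gaussianReal_Ici _ _ hv, eexp,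
    ← ENNReal.ofReal_mul (Real.exp_pos _).le, add_comm] at h
  change hockeyStick v 1 (ENNReal.ofReal (Real.exp ε)) = _
  rw [ENNReal.eq_sub_of_add_eq ENNReal.ofReal_ne_top h.symm,
    ← ENNReal.ofReal_sub _ (mul_nonneg (Real.exp_pos _).le (Phi_nonneg _)), g]
  have e1 : ((v : ℝ) / 2 - ε) / Real.sqrt v = Real.sqrt v / 2 - ε / Real.sqrt v := by
    field_simp
    linarith
  have e2 : (-(v : ℝ) / 2 - ε) / Real.sqrt v = -(Real.sqrt v / 2) - ε / Real.sqrt v := by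
    field_simp
    linarith
  rw [e1, e2]

/-! ### Singular values and the Frobenius norm -/

/-- `‖T x‖²` in an eigenbasis of `T† T`, whose eigenvalues are the squared singular values. -/
theorem norm_sq_eq_sum_singularValues_sq {E : Type*} [NormedAddCommGroup E]
    [InnerProductSpace ℝ E] [FiniteDimensional ℝ E] (T : E →ₗ[ℝ] E) {k : ℕ}
    (hk : Module.finrank ℝ E = k) (x : E) :
    ‖T x‖ ^ 2 = ∑ i : Fin k, T.singularValues i ^ 2 *
      inner ℝ (T.isSymmetric_adjoint_comp_self.eigenvectorBasis hk i) x ^ 2 := by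
  set b := T.isSymmetric_adjoint_comp_self.eigenvectorBasis hk with hb
  rw [← real_inner_self_eq_norm_sq, ← LinearMap.adjoint_inner_left, ← b.sum_inner_mul_inner]
  refine Finset.sum_congr rfl fun i _ => ?_
  have h1 : inner ℝ (LinearMap.adjoint T (T x)) (b i) =
      T.singularValues i ^ 2 * inner ℝ (b i) x := by
    have h2 := T.isSymmetric_adjoint_comp_self x (b i)
    rw [hb, LinearMap.IsSymmetric.apply_eigenvectorBasis, ← hb,
      ← T.sq_singularValues_fin hk i] at h2
    simpa [inner_smul_right, real_inner_comm] using h2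
  rw [h1]
  ring

/-- A square matrix stretches every vector at least by its last singular value. -/
theorem singularValue_last_sq_mul_le {k : ℕ} (hk : 0 < k) (A : Matrix (Fin k) (Fin k) ℝ)
    (x : Fin k → ℝ) :
    singularValue A k ^ 2 * (x ⬝ᵥ x) ≤ (A *ᵥ x) ⬝ᵥ (A *ᵥ x) := by
  have h := norm_sq_eq_sum_singularValues_sq A.toEuclideanLin
    (finrank_euclideanSpace_fin (𝕜 := ℝ) (n := k)) (WithLp.toLp 2 x)
  have h0 := (A.toEuclideanLin.isSymmetric_adjoint_comp_self.eigenvectorBasis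
    (finrank_euclideanSpace_fin (𝕜 := ℝ) (n := k))).sum_sq_inner_right (WithLp.toLp 2 x)
  have hx : ∀ y : Fin k → ℝ, ‖(WithLp.toLp 2 y : EuclideanSpace ℝ (Fin k))‖ ^ 2 = y ⬝ᵥ y := by
    intro y
    rw [EuclideanSpace.real_norm_sq_eq]
    simp [dotProduct, sq]
  rw [Matrix.toLpLin_toLp, Matrix.toLin'_apply, hx] at h
  rw [hx] at h0
  rw [h, ← h0, Finset.mul_sum]
  refine Finset.sum_le_sum fun i _ => ?_
  gcongr
  · exact LinearMap.singularValues_nonneg _ _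
  · exact A.toEuclideanLin.singularValues_antitone (by omega)

theorem exists_singularValue_last_eq {k : ℕ} (hk : 0 < k) (A : Matrix (Fin k) (Fin k) ℝ) :
    ∃ x : Fin k → ℝ, x ⬝ᵥ x = 1 ∧ (A *ᵥ x) ⬝ᵥ (A *ᵥ x) = singularValue A k ^ 2 := by
  set b := A.toEuclideanLin.isSymmetric_adjoint_comp_self.eigenvectorBasis
    (finrank_euclideanSpace_fin (𝕜 := ℝ) (n := k)) with hb
  have h := norm_sq_eq_sum_singularValues_sq A.toEuclideanLin
    (finrank_euclideanSpace_fin (𝕜 := ℝ) (n := k)) (b ⟨k - 1, by omega⟩)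
  have hx : ∀ y : EuclideanSpace ℝ (Fin k), y.ofLp ⬝ᵥ y.ofLp = ‖y‖ ^ 2 := by
    intro y
    rw [EuclideanSpace.real_norm_sq_eq]
    simp [dotProduct, sq]
  refine ⟨(b ⟨k - 1, by omega⟩).ofLp, ?_, ?_⟩
  · rw [hx, b.norm_eq_one, one_pow]
  · rw [← Matrix.toLin'_apply, ← Matrix.ofLp_toLpLin 2 2, hx, h, ← hb]
    simp only [b.inner_eq_ite]
    simp [singularValue]

theorem singularValue_last_pos {k : ℕ} (hk : 0 < k) {A : Matrix (Fin k) (Fin k) ℝ}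
    (hA : IsUnit A) : 0 < singularValue A k := by
  refine lt_of_le_of_ne (LinearMap.singularValues_nonneg _ _) fun h => ?_
  obtain ⟨x, hx, hAx⟩ := exists_singularValue_last_eq hk A
  rw [← h, zero_pow two_ne_zero, dotProduct_self_eq_zero] at hAx
  have : x = 0 := Matrix.mulVec_injective_of_isUnit hA (by rw [hAx, Matrix.mulVec_zero])
  simp [this] at hx

section
variable {m n : ℕ}

theorem frobNorm_nonneg (A : Matrix (Fin m) (Fin n) ℝ) : 0 ≤ frobNorm A := Real.sqrt_nonneg _

theorem frobNorm_sq (A : Matrix (Fin m) (Fin n) ℝ) : frobNorm A ^ 2 = ∑ i, ∑ j, A i j ^ 2 :=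
  Real.sq_sqrt (by positivity)

theorem frobNorm_transpose (A : Matrix (Fin m) (Fin n) ℝ) : frobNorm Aᵀ = frobNorm A := by
  unfold frobNorm
  rw [Finset.sum_comm]
  rfl

theorem frobNorm_zero : frobNorm (0 : Matrix (Fin m) (Fin n) ℝ) = 0 := by simp [frobNorm]

theorem frobNorm_neg (A : Matrix (Fin m) (Fin n) ℝ) : frobNorm (-A) = frobNorm A := by
  simp [frobNorm]

theorem frobNorm_smul (c : ℝ) (A : Matrix (Fin m) (Fin n) ℝ) :
    frobNorm (c • A) = |c| * frobNorm A := by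
  simp only [frobNorm, Matrix.smul_apply, smul_eq_mul, mul_pow, ← Finset.mul_sum]
  rw [Real.sqrt_mul (sq_nonneg c), Real.sqrt_sq_eq_abs]

theorem frobNorm_vecMulVec (x : Fin m → ℝ) (y : Fin n → ℝ) :
    frobNorm (Matrix.vecMulVec x y) = Real.sqrt ((x ⬝ᵥ x) * (y ⬝ᵥ y)) := by
  simp only [frobNorm, Matrix.vecMulVec_apply, dotProduct, Finset.sum_mul_sum]
  congr 1
  exact Finset.sum_congr rfl fun i _ => Finset.sum_congr rfl fun j _ => by ring

theorem singularValue_mul_frobNorm_le (hm : 0 < m) (U : Matrix (Fin m) (Fin m) ℝ)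
    (W : Matrix (Fin m) (Fin n) ℝ) :
    singularValue U m * frobNorm W ≤ frobNorm (U * W) := by
  refine le_of_sq_le_sq ?_ (frobNorm_nonneg _)
  rw [mul_pow, frobNorm_sq, frobNorm_sq, Finset.sum_comm, Finset.sum_comm (s := .univ (α := Fin m)),
    Finset.mul_sum]
  refine Finset.sum_le_sum fun j _ => ?_
  simpa [dotProduct, Matrix.mulVec, Matrix.mul_apply, sq] using
    singularValue_last_sq_mul_le hm U fun i => W i j

theorem singularValue_mul_mul_frobNorm_le (hm : 0 < m) (hn : 0 < n)
    (U₁ : Matrix (Fin m) (Fin m) ℝ) (U₂ : Matrix (Fin n) (Fin n) ℝ)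
    (W : Matrix (Fin m) (Fin n) ℝ) :
    singularValue U₁ m * singularValue U₂ n * frobNorm W ≤ frobNorm (U₁ * W * U₂ᵀ) := by
  have h1 := singularValue_mul_frobNorm_le hm U₁ (W * U₂ᵀ)
  have h2 := singularValue_mul_frobNorm_le hn U₂ Wᵀ
  rw [frobNorm_transpose, ← frobNorm_transpose (U₂ * Wᵀ), Matrix.transpose_mul,
    Matrix.transpose_transpose] at h2
  rw [mul_assoc, Matrix.mul_assoc]
  exact (mul_le_mul_of_nonneg_left h2 (LinearMap.singularValues_nonneg _ _)).trans h1

/-- Equality holds for the rank-one matrices built from minimal right singular vectors. -/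
theorem exists_frobNorm_eq (hm : 0 < m) (hn : 0 < n)
    (U₁ : Matrix (Fin m) (Fin m) ℝ) (U₂ : Matrix (Fin n) (Fin n) ℝ) {r : ℝ} (hr : 0 ≤ r) :
    ∃ W : Matrix (Fin m) (Fin n) ℝ, frobNorm W = r ∧
      frobNorm (U₁ * W * U₂ᵀ) = singularValue U₁ m * singularValue U₂ n * r := by
  obtain ⟨x, hx, hUx⟩ := exists_singularValue_last_eq hm U₁
  obtain ⟨y, hy, hUy⟩ := exists_singularValue_last_eq hn U₂
  refine ⟨r • Matrix.vecMulVec x y, ?_, ?_⟩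
  · rw [frobNorm_smul, frobNorm_vecMulVec, hx, hy, abs_of_nonneg hr]
    simp
  · have : U₁ * (r • Matrix.vecMulVec x y) * U₂ᵀ = r • Matrix.vecMulVec (U₁ *ᵥ x) (U₂ *ᵥ y) := by
      rw [Matrix.mul_smul, Matrix.smul_mul, Matrix.mul_vecMulVec, Matrix.vecMulVec_mul,
        Matrix.vecMul_transpose]
    rw [this, frobNorm_smul, frobNorm_vecMulVec, hUx, hUy, abs_of_nonneg hr, ← mul_pow,
      Real.sqrt_sq, mul_comm]
    exact mul_nonneg (LinearMap.singularValues_nonneg _ _) (LinearMap.singularValues_nonneg _ _)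

end

/-! ### Matrix Gaussians as images of independent standard normals -/

/-- A product of measures with densities has the product density. -/
theorem pi_withDensity {Ω : Type*} [MeasurableSpace Ω] {n : ℕ} (μ : Fin n → Measure Ω)
    (f : Fin n → Ω → ℝ≥0∞) (hf : ∀ i, Measurable (f i)) [∀ i, SigmaFinite (μ i)]
    [∀ i, SigmaFinite ((μ i).withDensity (f i))] :
    Measure.pi (fun i => (μ i).withDensity (f i)) =
      (Measure.pi μ).withDensity fun z => ∏ i, f i (z i) := by
  induction n with
  | zero =>
    rw [Measure.pi_of_empty _, Measure.pi_of_empty μ]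
    simp
  | succ n ih =>
    have hP := (measurePreserving_piFinSuccAbove (fun i => (μ i).withDensity (f i)) 0).symm.map_eq
    have hQ := (measurePreserving_piFinSuccAbove μ 0).symm.map_eq
    rw [← hP, ← hQ, ih _ _ fun i => hf _, prod_withDensity (hf 0)
      (by fun_prop : Measurable fun z : Fin n → Ω => ∏ i, f (Fin.succAbove 0 i) (z i)),
      map_withDensity]
    congr 1
    ext z
    simp [Fin.prod_univ_succ, MeasurableEquiv.piFinSuccAbove, Fin.insertNthEquiv, Fin.tail]

section
variable {m n : ℕ}

/-- The law of a random matrix with independent entries of unit variance and mean `M`. -/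
def stdMatrixGaussian (M : Matrix (Fin m) (Fin n) ℝ) : Measure (Matrix (Fin m) (Fin n) ℝ) :=
  Measure.pi (α := fun _ : Fin m => Fin n → ℝ) fun i => Measure.pi fun j => gaussianReal (M i j) 1

theorem map_add_stdMatrixGaussian (M : Matrix (Fin m) (Fin n) ℝ) :
    (stdMatrixGaussian 0).map (fun W => M + W) = stdMatrixGaussian M := by
  have h : ∀ i, (Measure.pi fun _ : Fin n => gaussianReal 0 1).map (fun w => M i + w) =
      Measure.pi fun j => gaussianReal (M i j) 1 := by
    intro i
    have := Measure.pi_map_pi (μ := fun _ : Fin n => gaussianReal 0 1)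
      (f := fun j w => M i j + w) (fun j => by fun_prop)
    simp only [gaussianReal_map_const_add, zero_add] at this
    exact this
  have := Measure.pi_map_pi (μ := fun _ : Fin m => Measure.pi fun _ : Fin n => gaussianReal 0 1)
    (f := fun i w => M i + w) (fun i => by fun_prop)
  simp only [h] at this
  exact this

theorem gaussianLoss_stdMatrixGaussian (M M' : Matrix (Fin m) (Fin n) ℝ) :
    GaussianLoss (stdMatrixGaussian M) (stdMatrixGaussian M')
      (Real.toNNReal (frobNorm (M - M') ^ 2)) := by
  have h : Real.toNNReal (frobNorm (M - M') ^ 2) =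
      ∑ i, ∑ j, Real.toNNReal ((M i j - M' i j) ^ 2) := by
    rw [frobNorm_sq, Real.toNNReal_sum_of_nonneg fun i _ => by positivity]
    refine Finset.sum_congr rfl fun i _ => ?_
    rw [Real.toNNReal_sum_of_nonneg fun i _ => by positivity]
    rfl
  have hp : ∀ (M : Matrix (Fin m) (Fin n) ℝ) i,
      IsProbabilityMeasure (Measure.pi fun j => gaussianReal (M i j) 1) := fun M i => inferInstance
  have hM := hp M
  have hM' := hp M'
  rw [h]
  exact GaussianLoss.pi fun i => GaussianLoss.pi fun j => gaussianLoss_gaussianReal _ _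

theorem pi_gaussianReal (n : ℕ) : (Measure.pi fun _ : Fin n => gaussianReal 0 1) =
    volume.withDensity fun w => ∏ j, gaussianPDF 0 1 (w j) := by
  have : SigmaFinite ((volume : Measure ℝ).withDensity (gaussianPDF 0 1)) := by
    rw [← gaussianReal_of_var_ne_zero 0 one_ne_zero]; infer_instance
  rw [gaussianReal_of_var_ne_zero 0 one_ne_zero,
    pi_withDensity _ _ fun _ => measurable_gaussianPDF 0 1]
  rfl

theorem stdMatrixGaussian_zero :
    stdMatrixGaussian (0 : Matrix (Fin m) (Fin n) ℝ) = volume.withDensity fun W =>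
      ENNReal.ofReal ((Real.sqrt (2 * Real.pi))⁻¹ ^ (m * n) *
        Real.exp (-(1 / 2) * frobNorm W ^ 2)) := by
  have : SigmaFinite ((volume : Measure (Fin n → ℝ)).withDensity
      fun w => ∏ j, gaussianPDF 0 1 (w j)) := by
    rw [← pi_gaussianReal]; infer_instance
  have h : stdMatrixGaussian (0 : Matrix (Fin m) (Fin n) ℝ) =
      Measure.pi (α := fun _ : Fin m => Fin n → ℝ) fun i => volume.withDensity
        fun w => ∏ j, gaussianPDF 0 1 (w j) := by
    rw [← pi_gaussianReal]
    rfl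
  have hf : Measurable fun w : Fin n → ℝ => ∏ j, gaussianPDF 0 1 (w j) :=
    Finset.measurable_fun_prod _ fun j _ =>
      (measurable_gaussianPDF 0 1).comp (measurable_pi_apply j)
  rw [h]
  refine (pi_withDensity (fun _ : Fin m => (volume : Measure (Fin n → ℝ))) _ fun _ => hf).trans ?_
  change (volume : Measure (Matrix (Fin m) (Fin n) ℝ)).withDensity _ = _
  congr 1
  funext W
  simp only [gaussianPDF]
  simp_rw [← ENNReal.ofReal_prod_of_nonneg fun _ _ => gaussianPDFReal_nonneg _ _ _]
  rw [← ENNReal.ofReal_prod_of_nonneg fun _ _ =>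
    Finset.prod_nonneg fun _ _ => gaussianPDFReal_nonneg _ _ _]
  simp only [gaussianPDFReal, Finset.prod_mul_distrib, Finset.prod_const, Finset.card_univ,
    Fintype.card_fin, ← Real.exp_sum]
  rw [← pow_mul, mul_comm n m]
  simp only [NNReal.coe_one, mul_one, sub_zero]
  congr 3
  refine Eq.trans ?_ (congrArg _ (frobNorm_sq W).symm)
  simp only [Finset.mul_sum]
  exact Finset.sum_congr rfl fun i _ => Finset.sum_congr rfl fun j _ => by ring

/-- The linear map `W ↦ U₁ W U₂ᵀ`, as the Kronecker product of `U₁` and `U₂` acting on the entries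
of `W`. -/
def sandwichLin (U₁ : Matrix (Fin m) (Fin m) ℝ) (U₂ : Matrix (Fin n) (Fin n) ℝ) :
    (Fin m → Fin n → ℝ) →ₗ[ℝ] (Fin m → Fin n → ℝ) :=
  (LinearEquiv.curry ℝ ℝ (Fin m) (Fin n)).toLinearMap ∘ₗ
    Matrix.toLin' (Matrix.kroneckerMap (fun a b => a * b) U₁ U₂) ∘ₗ
      (LinearEquiv.curry ℝ ℝ (Fin m) (Fin n)).symm.toLinearMap

theorem sandwichLin_apply (U₁ : Matrix (Fin m) (Fin m) ℝ) (U₂ : Matrix (Fin n) (Fin n) ℝ)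
    (W : Matrix (Fin m) (Fin n) ℝ) : sandwichLin U₁ U₂ W = U₁ * W * U₂ᵀ := by
  funext i j
  change (Matrix.kroneckerMap (fun a b => a * b) U₁ U₂ *ᵥ Function.uncurry W) (i, j) = _
  simp only [Matrix.mulVec, dotProduct, Matrix.kroneckerMap_apply, Fintype.sum_prod_type,
    Matrix.mul_apply, Matrix.transpose_apply, Finset.sum_mul]
  rw [Finset.sum_comm]
  refine Finset.sum_congr rfl fun j' _ => Finset.sum_congr rfl fun i' _ => ?_
  change U₁ i i' * U₂ j j' * W i' j' = _
  ring

theorem det_sandwichLin (U₁ : Matrix (Fin m) (Fin m) ℝ) (U₂ : Matrix (Fin n) (Fin n) ℝ) :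
    LinearMap.det (sandwichLin U₁ U₂) = U₁.det ^ n * U₂.det ^ m := by
  rw [sandwichLin, LinearMap.det_conj, LinearMap.det_toLin', Matrix.det_kronecker]
  simp

theorem measurable_sandwich (U₁ : Matrix (Fin m) (Fin m) ℝ) (U₂ : Matrix (Fin n) (Fin n) ℝ) :
    Measurable fun W : Matrix (Fin m) (Fin n) ℝ => U₁ * W * U₂ᵀ := by
  have h : Measurable (sandwichLin U₁ U₂) :=
    (LinearMap.continuous_of_finiteDimensional _).measurable
  exact (funext (sandwichLin_apply U₁ U₂) : (sandwichLin U₁ U₂ : _ → _) = _) ▸ h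

/-- For invertible `U₁` and `U₂`, the map `W ↦ U₁ W U₂ᵀ` as a measurable equivalence. -/
def sandwich {U₁ : Matrix (Fin m) (Fin m) ℝ} {U₂ : Matrix (Fin n) (Fin n) ℝ}
    (hU₁ : IsUnit U₁) (hU₂ : IsUnit U₂) :
    Matrix (Fin m) (Fin n) ℝ ≃ᵐ Matrix (Fin m) (Fin n) ℝ where
  toFun W := U₁ * W * U₂ᵀ
  invFun Z := U₁⁻¹ * Z * (U₂⁻¹)ᵀ
  left_inv W := by
    have h1 := (Matrix.isUnit_iff_isUnit_det _).mp hU₁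
    have h2 := (Matrix.isUnit_iff_isUnit_det _).mp hU₂
    beta_reduce
    rw [Matrix.mul_assoc, Matrix.mul_assoc, Matrix.mul_assoc, ← Matrix.transpose_mul,
      Matrix.nonsing_inv_mul _ h2,
      Matrix.transpose_one, Matrix.mul_one, Matrix.nonsing_inv_mul_cancel_left _ _ h1]
  right_inv Z := by
    have h1 := (Matrix.isUnit_iff_isUnit_det _).mp hU₁
    have h2 := (Matrix.isUnit_iff_isUnit_det _).mp hU₂
    beta_reduce
    rw [Matrix.mul_assoc, Matrix.mul_assoc, Matrix.mul_assoc, ← Matrix.transpose_mul,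
      Matrix.mul_nonsing_inv _ h2,
      Matrix.transpose_one, Matrix.mul_one, Matrix.mul_nonsing_inv_cancel_left _ _ h1]
  measurable_toFun := measurable_sandwich _ _
  measurable_invFun := measurable_sandwich _ _

theorem map_sandwich_volume {U₁ : Matrix (Fin m) (Fin m) ℝ} {U₂ : Matrix (Fin n) (Fin n) ℝ}
    (hU₁ : IsUnit U₁) (hU₂ : IsUnit U₂) :
    (volume : Measure (Matrix (Fin m) (Fin n) ℝ)).map (sandwich hU₁ hU₂) =
      ENNReal.ofReal (|U₁.det| ^ n * |U₂.det| ^ m)⁻¹ • volume := by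
  have h1 := ((Matrix.isUnit_iff_isUnit_det _).mp hU₁).ne_zero
  have h2 := ((Matrix.isUnit_iff_isUnit_det _).mp hU₂).ne_zero
  have h := Measure.map_linearMap_addHaar_eq_smul_addHaar
    (volume : Measure (Fin m → Fin n → ℝ)) (f := sandwichLin U₁ U₂)
    (by rw [det_sandwichLin]; positivity)
  rw [det_sandwichLin, abs_inv, abs_mul, abs_pow, abs_pow,
    (funext (sandwichLin_apply U₁ U₂) : (sandwichLin U₁ U₂ : _ → _) = _)] at h
  exact h

/-- A matrix Gaussian with covariances `U₁ U₁ᵀ` and `U₂ U₂ᵀ` is `U₁ W U₂ᵀ` for a matrix `W` of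
independent standard normal entries. -/
theorem matrixGaussian_eq_map {U₁ : Matrix (Fin m) (Fin m) ℝ} {U₂ : Matrix (Fin n) (Fin n) ℝ}
    (hU₁ : IsUnit U₁) (hU₂ : IsUnit U₂) :
    matrixGaussian (0 : Matrix (Fin m) (Fin n) ℝ) (U₁ * U₁ᵀ) (U₂ * U₂ᵀ) =
      (stdMatrixGaussian 0).map (sandwich hU₁ hU₂) := by
  rw [stdMatrixGaussian_zero, map_withDensity, map_sandwich_volume, withDensity_smul_measure,
    ← withDensity_smul']
  swap
  · exact ENNReal.ofReal_ne_top
  rw [matrixGaussian]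
  congr 1
  funext Z
  have hpow : ∀ (d : ℝ) (k : ℕ), (d * d) ^ ((k : ℝ) / 2) = |d| ^ k := by
    intro d k
    rw [← sq, ← sq_abs, ← Real.rpow_natCast, ← Real.rpow_mul (abs_nonneg d)]
    rw [← Real.rpow_natCast]
    congr 1
    push_cast
    ring
  have hpi : (2 * Real.pi) ^ (((m : ℝ) * n) / 2) = Real.sqrt (2 * Real.pi) ^ (m * n) := by
    rw [← Real.mul_self_sqrt (by positivity : (0 : ℝ) ≤ 2 * Real.pi), ← Nat.cast_mul, hpow,
      Real.mul_self_sqrt (by positivity), abs_of_nonneg (Real.sqrt_nonneg _)]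
  simp only [Pi.smul_apply, Function.comp_apply, smul_eq_mul]
  rw [← ENNReal.ofReal_mul (by positivity), matrixGaussianPDF, sub_zero, trace_eq_frobNorm_sq,
    Matrix.det_mul, Matrix.det_mul, Matrix.det_transpose, Matrix.det_transpose, hpow, hpow, hpi]
  congr 1
  change _ = _ * (_ * Real.exp (-(1 / 2) * frobNorm (U₁⁻¹ * Z * (U₂⁻¹)ᵀ) ^ 2))
  rw [inv_pow, div_eq_inv_mul, mul_inv, mul_inv, mul_inv]
  ring

theorem map_add_matrixGaussian {U₁ : Matrix (Fin m) (Fin m) ℝ} {U₂ : Matrix (Fin n) (Fin n) ℝ}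
    (hU₁ : IsUnit U₁) (hU₂ : IsUnit U₂) (F : Matrix (Fin m) (Fin n) ℝ) :
    (matrixGaussian 0 (U₁ * U₁ᵀ) (U₂ * U₂ᵀ)).map (fun Z => F + Z) =
      (stdMatrixGaussian (U₁⁻¹ * F * (U₂⁻¹)ᵀ)).map (sandwich hU₁ hU₂) := by
  have hF : ∀ F : Matrix (Fin m) (Fin n) ℝ, Measurable fun Z => F + Z := fun F =>
    measurable_matrix_add.comp (measurable_const.prodMk measurable_id)
  rw [matrixGaussian_eq_map hU₁ hU₂, ← map_add_stdMatrixGaussian (U₁⁻¹ * F * (U₂⁻¹)ᵀ),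
    Measure.map_map (hF F) (sandwich hU₁ hU₂).measurable,
    Measure.map_map (sandwich hU₁ hU₂).measurable (hF _)]
  congr 1
  funext W
  have h := (sandwich hU₁ hU₂).right_inv F
  change U₁ * (U₁⁻¹ * F * (U₂⁻¹)ᵀ) * U₂ᵀ = F at h
  change F + U₁ * W * U₂ᵀ = U₁ * (U₁⁻¹ * F * (U₂⁻¹)ᵀ + W) * U₂ᵀ
  rw [Matrix.mul_add, Matrix.add_mul, h]

/-- The log-likelihood ratio of two matrix Gaussians that differ by `F - F'` is Gaussian; the
squared distance is measured in whitened coordinates. -/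
theorem gaussianLoss_matrixGaussian {U₁ : Matrix (Fin m) (Fin m) ℝ}
    {U₂ : Matrix (Fin n) (Fin n) ℝ} (hU₁ : IsUnit U₁) (hU₂ : IsUnit U₂)
    (F F' : Matrix (Fin m) (Fin n) ℝ) :
    GaussianLoss ((matrixGaussian 0 (U₁ * U₁ᵀ) (U₂ * U₂ᵀ)).map (fun Z => F + Z))
      ((matrixGaussian 0 (U₁ * U₁ᵀ) (U₂ * U₂ᵀ)).map (fun Z => F' + Z))
      (Real.toNNReal (frobNorm (U₁⁻¹ * (F - F') * (U₂⁻¹)ᵀ) ^ 2)) := by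
  rw [map_add_matrixGaussian hU₁ hU₂, map_add_matrixGaussian hU₁ hU₂, Matrix.mul_sub,
    Matrix.sub_mul]
  exact (gaussianLoss_stdMatrixGaussian _ _).map _

instance : IsProbabilityMeasure (stdMatrixGaussian (m := m) (n := n) 0) :=
  inferInstanceAs (IsProbabilityMeasure
    (Measure.pi (α := fun _ : Fin m => Fin n → ℝ) fun _ => Measure.pi fun _ => gaussianReal 0 1))

theorem isProbabilityMeasure_matrixGaussian {U₁ : Matrix (Fin m) (Fin m) ℝ}
    {U₂ : Matrix (Fin n) (Fin n) ℝ} (hU₁ : IsUnit U₁) (hU₂ : IsUnit U₂) :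
    IsProbabilityMeasure (matrixGaussian (0 : Matrix (Fin m) (Fin n) ℝ) (U₁ * U₁ᵀ) (U₂ * U₂ᵀ)) := by
  rw [matrixGaussian_eq_map hU₁ hU₂]
  exact Measure.isProbabilityMeasure_map (sandwich hU₁ hU₂).measurable.aemeasurable

end

/-! ### Composition of matrix Gaussian mechanisms -/

section
variable {X R : Type*} [MeasurableSpace R]

/-- Appending an entry to a tuple, as a measurable equivalence. -/
def snocEquiv (R : Type*) [MeasurableSpace R] (T : ℕ) : (Fin T → R) × R ≃ᵐ (Fin (T + 1) → R) where
  toFun p := Fin.snoc (α := fun _ => R) p.1 p.2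
  invFun q := (Fin.init q, q (Fin.last T))
  left_inv p := by simp
  right_inv q := by simp
  measurable_toFun := measurable_finSnoc T
  measurable_invFun := by
    refine Measurable.prodMk (measurable_pi_lambda _ fun i => ?_) (measurable_pi_apply _)
    exact measurable_pi_apply _

variable (K : (t : ℕ) → X → Kernel (Fin t → R) R) [∀ t x, IsMarkovKernel (K t x)]

instance isProbabilityMeasure_adaptiveComposition (T : ℕ) (x : X) :
    IsProbabilityMeasure (adaptiveComposition K T x) := by
  induction T with
  | zero => exact Measure.dirac.isProbabilityMeasure
  | succ T ih => exact Measure.isProbabilityMeasure_map (measurable_finSnoc T).aemeasurable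

/-- Bounds on the single rounds that are uniform in the earlier outputs bound the composition. -/
theorem dominated_adaptiveComposition {x x' : X} {v : ℝ≥0} {T : ℕ}
    (h : ∀ t < T, ∀ y, Dominated (K t x y) (K t x' y) v) :
    Dominated (adaptiveComposition K T x) (adaptiveComposition K T x') (T * v) := by
  induction T with
  | zero =>
    rw [Nat.cast_zero, zero_mul]
    exact (GaussianLoss.refl (Measure.dirac Fin.elim0)).dominated
  | succ T ih =>
    rw [Nat.cast_succ, add_mul, one_mul]
    exact ((ih fun t ht => h t (ht.trans T.lt_succ_self)).compProd (h T T.lt_succ_self)).map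
      (measurable_finSnoc T)

/-- When the rounds ignore the earlier outputs, the composition is a product and the losses add up
exactly. -/
theorem gaussianLoss_adaptiveComposition_const {μ : X → Measure R}
    (hK : ∀ t x, K t x = Kernel.const _ (μ x)) [∀ x, IsProbabilityMeasure (μ x)] {x x' : X}
    {v : ℝ≥0} (h : GaussianLoss (μ x) (μ x') v) (T : ℕ) :
    GaussianLoss (adaptiveComposition K T x) (adaptiveComposition K T x') (T * v) := by
  induction T with
  | zero =>
    rw [Nat.cast_zero, zero_mul]
    exact GaussianLoss.refl (Measure.dirac Fin.elim0)
  | succ T ih =>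
    rw [Nat.cast_succ, add_mul, one_mul, adaptiveComposition, adaptiveComposition, hK, hK,
      Measure.compProd_const, Measure.compProd_const]
    exact (ih.prod h).map (snocEquiv R T)

end

section
variable {X : Type*} {adj : X → X → Prop} {m n : ℕ}

/-- Two unit-variance Gaussians satisfy the `(ε, δ)`-bound exactly if their distance is at most the
root `B` of `g ε B = δ`. Distance `0` is treated apart, since `g ε 0` is a junk value. -/
theorem hockeyStick_le_iff {ε δ B : ℝ} (hδ : 0 < δ) (hB : 0 < B) (hgB : g ε B = δ) (hε : 0 ≤ ε)
    (v : ℝ≥0) : hockeyStick v 1 (eexp ε) ≤ ENNReal.ofReal δ ↔ Real.sqrt v ≤ B := by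
  rcases eq_or_ne v 0 with rfl | hv
  · have h : hockeyStick 0 1 (eexp ε) = 0 := by
      have h1 : (1 : ℝ≥0∞) ≤ eexp ε := by
        rw [eexp, ENNReal.one_le_ofReal]
        exact Real.one_le_exp hε
      have h2 : lossLaw 0 = Measure.dirac 0 := by simp [lossLaw, gaussianReal_zero_var]
      have h3 : eexp 0 = 1 := by simp [eexp]
      rw [hockeyStick, h2, lintegral_dirac' _ (by fun_prop), h3, one_mul,
        tsub_eq_zero_of_le h1]
    simp [h, hB.le]
  · have hs : 0 < Real.sqrt v := Real.sqrt_pos.mpr (by positivity)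
    rw [hockeyStick_one_eexp ε hv, ENNReal.ofReal_le_ofReal_iff hδ.le, ← hgB]
    exact (strictMonoOn_g ε).le_iff_le hs hB

theorem frobNorm_le_of_l2Sensitivity_le {f : X → Matrix (Fin m) (Fin n) ℝ} {s : ℝ≥0}
    (h : l2Sensitivity adj f ≤ s) {x x' : X} (hx : adj x x') : frobNorm (f x - f x') ≤ s := by
  have h1 : ENNReal.ofReal (frobNorm (f x - f x')) ≤ s :=
    (le_iSup_of_le x (le_iSup_of_le x' (le_iSup
      (fun _ : adj x x' => ENNReal.ofReal (frobNorm (f x - f x'))) hx))).trans h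
  rwa [ENNReal.ofReal_le_coe] at h1

/-- For a pair `x ≠ x'` of adjacent datasets, the query with value `D` at `x` and `0` elsewhere has
sensitivity `‖D‖_F`. -/
theorem exists_l2Sensitivity_eq {x x' : X} (hx : adj x x') (hne : x ≠ x')
    (D : Matrix (Fin m) (Fin n) ℝ) : ∃ f : X → Matrix (Fin m) (Fin n) ℝ,
      l2Sensitivity adj f = ENNReal.ofReal (frobNorm D) ∧ f x - f x' = D := by
  classical
  refine ⟨fun z => if z = x then D else 0, le_antisymm ?_ ?_, by simp [hne.symm]⟩
  · refine iSup_le fun a => iSup_le fun b => iSup_le fun _ => ENNReal.ofReal_le_ofReal ?_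
    have h0 := frobNorm_nonneg D
    beta_reduce
    split_ifs <;> simp [frobNorm_zero, frobNorm_neg, h0]
  · refine le_iSup_of_le x (le_iSup_of_le x' (le_iSup_of_le hx ?_))
    simp [hne.symm]

variable {U₁ : Matrix (Fin m) (Fin m) ℝ} {U₂ : Matrix (Fin n) (Fin n) ℝ}

theorem isMarkovKernel_imgm (hU₁ : IsUnit U₁) (hU₂ : IsUnit U₂) {Y : Type*} [MeasurableSpace Y]
    (q : Y → Matrix (Fin m) (Fin n) ℝ) (hq : Measurable q) :
    IsMarkovKernel (imgm (U₁ * U₁ᵀ) (U₂ * U₂ᵀ) q hq) := by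
  have := isProbabilityMeasure_matrixGaussian (m := m) (n := n) hU₁ hU₂
  refine ⟨fun y => Measure.isProbabilityMeasure_map (Measurable.aemeasurable ?_)⟩
  exact measurable_matrix_add.comp (measurable_const.prodMk measurable_id)

theorem sandwich_inv (hU₁ : IsUnit U₁) (hU₂ : IsUnit U₂) (D : Matrix (Fin m) (Fin n) ℝ) :
    U₁ * (U₁⁻¹ * D * (U₂⁻¹)ᵀ) * U₂ᵀ = D :=
  (sandwich hU₁ hU₂).right_inv D

theorem inv_sandwich (hU₁ : IsUnit U₁) (hU₂ : IsUnit U₂) (W : Matrix (Fin m) (Fin n) ℝ) :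
    U₁⁻¹ * (U₁ * W * U₂ᵀ) * (U₂⁻¹)ᵀ = W :=
  (sandwich hU₁ hU₂).left_inv W

/-- The condition on the singular values says that the total squared distance, `T` times the
largest squared distance `(s / (σ_m(U₁) σ_n(U₂))) ^ 2` of one round, is at most `B ^ 2`. -/
theorem sqrt_total_le_iff {σ B : ℝ} (hσ : 0 < σ) (hB : 0 < B) (s : ℝ≥0) (T : ℕ) :
    Real.sqrt ((T * Real.toNNReal ((s / σ) ^ 2) : ℝ≥0) : ℝ) ≤ B ↔ σ ≥ s * Real.sqrt T / B := by
  rw [NNReal.coe_mul, NNReal.coe_natCast, Real.coe_toNNReal _ (sq_nonneg _),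
    Real.sqrt_mul (Nat.cast_nonneg T), Real.sqrt_sq (by positivity), ge_iff_le, div_le_iff₀ hB,
    ← mul_div_assoc, div_le_iff₀ hσ, mul_comm _ (s : ℝ), mul_comm B]

theorem isDP_adaptiveIMGM (hm : 0 < m) (hn : 0 < n) (hU₁ : IsUnit U₁) (hU₂ : IsUnit U₂)
    {ε δ B : ℝ} (hδ : 0 < δ) (hB : 0 < B) (hgB : g ε B = δ) (hε : 0 ≤ ε) {s : ℝ≥0} {T : ℕ}
    (hs : singularValue U₁ m * singularValue U₂ n ≥ s * Real.sqrt T / B)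
    (f : (t : ℕ) → (Fin t → Matrix (Fin m) (Fin n) ℝ) → X → Matrix (Fin m) (Fin n) ℝ)
    (hf : ∀ t x, Measurable fun y => f t y x)
    (hsens : ∀ t < T, ∀ y, l2Sensitivity adj (f t y) ≤ s) :
    IsDP adj (adaptiveIMGM (U₁ * U₁ᵀ) (U₂ * U₂ᵀ) f hf T) ε δ := by
  intro x x' hx O hO
  have hσ := mul_pos (singularValue_last_pos hm hU₁) (singularValue_last_pos hn hU₂)
  have := fun t x => isMarkovKernel_imgm hU₁ hU₂ (fun y => f t y x) (hf t x)
  have hdom := dominated_adaptiveComposition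
    (fun t x => imgm (U₁ * U₁ᵀ) (U₂ * U₂ᵀ) (fun y => f t y x) (hf t x)) (x := x) (x' := x')
    (v := Real.toNNReal ((s / (singularValue U₁ m * singularValue U₂ n)) ^ 2)) (T := T)
    fun t ht y => by
      refine (gaussianLoss_matrixGaussian hU₁ hU₂ (f t y x) (f t y x')).dominated.mono ?_
      refine Real.toNNReal_le_toNNReal (pow_le_pow_left₀ (frobNorm_nonneg _) ?_ 2)
      rw [le_div_iff₀ hσ, mul_comm]
      refine (singularValue_mul_mul_frobNorm_le hm hn _ _ _).trans ?_
      rw [sandwich_inv hU₁ hU₂]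
      exact frobNorm_le_of_l2Sensitivity_le (hsens t ht y) hx
  have h := hdom 1 (eexp ε) (eexp_ne_top ε) O hO
  rw [one_mul] at h
  refine h.trans (add_le_add le_rfl ?_)
  exact (hockeyStick_le_iff hδ hB hgB hε _).mpr ((sqrt_total_le_iff hσ hB s T).mpr hs)

/-- A pair of adjacent datasets at which the query difference is stretched as much as possible by
the whitening map forces the bound on the singular values. -/
theorem le_of_isDP_composedIMGM (hm : 0 < m) (hn : 0 < n) (hU₁ : IsUnit U₁) (hU₂ : IsUnit U₂)
    {ε δ B : ℝ} (hδ : 0 < δ) (hB : 0 < B) (hgB : g ε B = δ) (hε : 0 ≤ ε) {s : ℝ≥0} {T : ℕ}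
    {f : X → Matrix (Fin m) (Fin n) ℝ} {x x' : X} (hx : adj x x')
    (hD : frobNorm (U₁⁻¹ * (f x - f x') * (U₂⁻¹)ᵀ) =
      s / (singularValue U₁ m * singularValue U₂ n))
    (hDP : IsDP adj (composedIMGM (U₁ * U₁ᵀ) (U₂ * U₂ᵀ) f T) ε δ) :
    singularValue U₁ m * singularValue U₂ n ≥ s * Real.sqrt T / B := by
  have hσ := mul_pos (singularValue_last_pos hm hU₁) (singularValue_last_pos hn hU₂)
  have := fun (t : ℕ) x => isMarkovKernel_imgm hU₁ hU₂ 
    (fun _ : Fin t → Matrix (Fin m) (Fin n) ℝ => f x) measurable_const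
  have hprob : ∀ x, IsProbabilityMeasure
      ((matrixGaussian 0 (U₁ * U₁ᵀ) (U₂ * U₂ᵀ)).map fun Z => f x + Z) := fun x =>
    (this 0 x).isProbabilityMeasure Fin.elim0
  have hloss := gaussianLoss_matrixGaussian hU₁ hU₂ (f x) (f x')
  rw [hD] at hloss
  obtain ⟨O, hO, hPO⟩ := (gaussianLoss_adaptiveComposition_const
    (fun t x => imgm (U₁ * U₁ᵀ) (U₂ * U₂ᵀ)
      (fun _ : Fin t → Matrix (Fin m) (Fin n) ℝ => f x) measurable_const)
    (μ := fun x => (matrixGaussian 0 (U₁ * U₁ᵀ) (U₂ * U₂ᵀ)).map fun Z => f x + Z)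
    (fun t x => rfl) hloss T).exists_eq (eexp ε)
  have h := hDP x x' hx O hO
  unfold composedIMGM adaptiveIMGM at h
  rw [hPO] at h
  have h2 := (ENNReal.add_le_add_iff_left
    (ENNReal.mul_ne_top (eexp_ne_top ε) (measure_ne_top _ _))).mp h
  exact (sqrt_total_le_iff hσ hB s T).mp ((hockeyStick_le_iff hδ hB hgB hε _).mp h2)

/-- The worst-case query difference of a given Frobenius norm. -/
theorem exists_worst_case (hm : 0 < m) (hn : 0 < n) (hU₁ : IsUnit U₁) (hU₂ : IsUnit U₂) (s : ℝ≥0) :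
    ∃ D : Matrix (Fin m) (Fin n) ℝ, frobNorm D = s ∧ frobNorm (U₁⁻¹ * D * (U₂⁻¹)ᵀ) =
      s / (singularValue U₁ m * singularValue U₂ n) := by
  have hσ := mul_pos (singularValue_last_pos hm hU₁) (singularValue_last_pos hn hU₂)
  obtain ⟨W, hW, hUW⟩ := exists_frobNorm_eq hm hn U₁ U₂ (div_nonneg s.2 hσ.le)
  refine ⟨U₁ * W * U₂ᵀ, ?_, ?_⟩
  · rw [hUW, mul_div_cancel₀ _ hσ.ne']
    rfl
  · rw [inv_sandwich hU₁ hU₂, hW]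
    rfl

end

end IMGM

end

theorem mainTheorem2 {X : Type*} (adj : X → X → Prop)
    {m n : ℕ} (hm : 0 < m) (hn : 0 < n) (T : ℕ)
    (ε δ : ℝ) (hε : 0 ≤ ε) (hδ : 0 < δ) (hδ' : δ < 1)
    (S₁ U₁ : Matrix (Fin m) (Fin m) ℝ) (S₂ U₂ : Matrix (Fin n) (Fin n) ℝ)
    (hU₁ : IsUnit U₁) (hU₂ : IsUnit U₂)
    (hS₁ : U₁ * U₁ᵀ = S₁) (hS₂ : U₂ * U₂ᵀ = S₂) :
    (∃! B : ℝ, 0 < B ∧ IMGM.g ε B = δ) ∧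
    ∀ B : ℝ, 0 < B → IMGM.g ε B = δ → ∀ s : ℝ≥0,
      -- all queries of sensitivity `s`, the same query in every round or adaptive queries
      ((∃ x x', adj x x' ∧ x ≠ x') →
        List.TFAE [
          IMGM.singularValue U₁ m * IMGM.singularValue U₂ n ≥ s * Real.sqrt T / B,
          ∀ f : X → Matrix (Fin m) (Fin n) ℝ, IMGM.l2Sensitivity adj f = s →
            IMGM.IsDP adj (IMGM.composedIMGM S₁ S₂ f T) ε δ,
          ∀ (f : (t : ℕ) → (Fin t → Matrix (Fin m) (Fin n) ℝ) → X → Matrix (Fin m) (Fin n) ℝ)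
            (hf : ∀ t x, Measurable fun y => f t y x),
            (∀ t < T, ∀ y, IMGM.l2Sensitivity adj (f t y) ≤ s) →
            IMGM.IsDP adj (IMGM.adaptiveIMGM S₁ S₂ f hf T) ε δ]) ∧
      -- one query whose differences on adjacent pairs attain every matrix of Frobenius norm `s`
      (∀ f : X → Matrix (Fin m) (Fin n) ℝ, IMGM.l2Sensitivity adj f = s →
        (∀ D : Matrix (Fin m) (Fin n) ℝ, IMGM.frobNorm D = s →
          ∃ x x', adj x x' ∧ f x - f x' = D) →
        (IMGM.IsDP adj (IMGM.composedIMGM S₁ S₂ f T) ε δ ↔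
          IMGM.singularValue U₁ m * IMGM.singularValue U₂ n ≥ s * Real.sqrt T / B)) := by
  subst hS₁ hS₂
  refine ⟨IMGM.existsUnique_g_eq hε hδ hδ', fun B hB hgB s => ?_⟩
  obtain ⟨D, hDs, hD⟩ := IMGM.exists_worst_case hm hn hU₁ hU₂ s
  refine ⟨fun ⟨x, x', hx, hne⟩ => ?_, fun f hf hall => ⟨fun h => ?_, fun h => ?_⟩⟩
  · tfae_have 1 → 3 := fun h f hf hs =>
      IMGM.isDP_adaptiveIMGM hm hn hU₁ hU₂ hδ hB hgB hε h f hf hs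
    tfae_have 3 → 2 := fun h f hf =>
      h (fun _ _ => f) (fun _ _ => measurable_const) fun _ _ _ => hf.le
    tfae_have 2 → 1 := by
      intro h
      obtain ⟨f, hf, hfD⟩ := IMGM.exists_l2Sensitivity_eq hx hne D
      rw [hDs, ENNReal.ofReal_coe_nnreal] at hf
      exact IMGM.le_of_isDP_composedIMGM hm hn hU₁ hU₂ hδ hB hgB hε hx (hfD ▸ hD) (h f hf)
    tfae_finish
  · obtain ⟨x, x', hx, hfD⟩ := hall D hDs
    exact IMGM.le_of_isDP_composedIMGM hm hn hU₁ hU₂ hδ hB hgB hε hx (hfD ▸ hD) h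
  · exact IMGM.isDP_adaptiveIMGM hm hn hU₁ hU₂ hδ hB hgB hε h (fun _ _ => f)
      (fun _ _ => measurable_const) fun _ _ _ => hf.le
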